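/- For a finite alphabet $X$ and a binary relation $\rho\subseteq X^*\times X^*$ let $L_\rho=\{u\#v^{\mathrm{rev}} : (u,v)\in\rho\}$, where $\#\notin X$ is a new symbol and $v^{\mathrm{rev}}$ is the reverse of $v$. Let $\pi$ be the map from words over $(X\cup\{\varepsilon\})\times(X\cup\{\varepsilon\})$ to $X^*\times X^*$ given by $(x_1,y_1)\cdots(x_k,y_k)\mapsto(x_1\cdots x_k,\,y_1\cdots y_k)$. For a class $\mathfrak C$ of languages, let $U(\mathfrak C)$ be the class of all binary relations $\rho$ on words over finite alphabets with $L_\rho\in\mathfrak C$, and $T(\mathfrak C)$ the class of all such $\rho$ with $\rho=\pi(L)$ for some $L\in\mathfrak C$. Let $\mathcal{CF}$ be the class of context-free languages and $\mathcal O$ the class of one-counter languages, i.e. those recognized by nondeterministic finite automata, with $\varepsilon$-moves, that are equipped with a counter which holds a natural number and can be tested for zero (equivalently, by pushdown automata with one stack symbol besides the bottom marker). Then $U(\mathcal O)\subsetneq T(\mathcal O)$. Moreover, for the monoid $M_1=\langle a,b,\ell,r \mid \ell a^nb^nr=\ell b^na^nr\ (n\in\mathbb N)\rangle$, the word problem $\{(u,v)\in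 X^*\times X^* : u=_{M_1}v\}$, $X=\{a,b,\ell,r\}$, lies in $T(\mathcal O)$ but not in $U(\mathcal{CF})$. -/

import Mathlib

/-! Languages are Mathlib's `Language A`; `Option A` adjoins one extra value to `A`. -/

/-- A class of languages, over arbitrary alphabets. -/
abbrev LanguageClass : Type 1 := (A : Type) → Set (Language A)

/-- The class of context-free languages. -/
def ContextFreeClass : LanguageClass := fun _ => {L | L.IsContextFree}

/-! ### One-counter languages -/

/-- The effect of a transition on the counter. -/
inductive CounterOp where
  | inc
  | keep
  | dec

/-- A nondeterministic one-counter automaton over the input alphabet `A`, i.e. a pushdown automaton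
with a bottom marker and only one further stack symbol: finitely many states, a counter holding a
natural number that can be tested for zero, and moves without input.

`trans p x z op q` says that in state `p`, reading `x` (`none` for a move without input), the
automaton may apply `op` to the counter and go to state `q`, provided that the counter is zero
(if `z = true`), respectively nonzero (if `z = false`). -/
structure OneCounterAutomaton (A : Type) where
  State : Type
  finiteState : Finite State
  start : State
  accept : Set State
  trans : State → Option A → Bool → CounterOp → State → Prop

namespace OneCounterAutomaton

variable {A : Type} (M : OneCounterAutomaton A)

/-- One move between configurations (state and counter value), with the input read. A counter
that is zero cannot be decremented. -/
inductive Step : M.State × ℕ → Option A → M.State × ℕ → Prop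
  | inc {p q : M.State} {x : Option A} {n : ℕ} :
      M.trans p x (decide (n = 0)) CounterOp.inc q → Step (p, n) x (q, n + 1)
  | keep {p q : M.State} {x : Option A} {n : ℕ} :
      M.trans p x (decide (n = 0)) CounterOp.keep q → Step (p, n) x (q, n)
  | dec {p q : M.State} {x : Option A} {n : ℕ} :
      M.trans p x false CounterOp.dec q → Step (p, n + 1) x (q, n)

/-- `M.Run c w d`: some finite sequence of moves leads from `c` to `d` and reads the word `w`. -/
inductive Run : M.State × ℕ → List A → M.State × ℕ → Prop
  | refl (c : M.State × ℕ) : Run c [] c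
  | step {c d e : M.State × ℕ} {x : Option A} {w : List A} :
      M.Step c x d → Run d w e → Run c (x.toList ++ w) e

/-- The recognized language: the automaton starts with counter `0`, and accepts if, after
reading the whole input, it is in an accepting state and the counter is `0`. (As there are moves
without input, ignoring the final counter value would give the same class of languages.) -/
def language : Language A :=
  {w | ∃ f ∈ M.accept, M.Run (M.start, 0) w (f, 0)}

end OneCounterAutomaton

/-- The class of one-counter languages. -/
def OneCounterClass : LanguageClass := fun A => {L | ∃ M : OneCounterAutomaton A, M.language = L}

/-! ### Relations on words -/

/-- A binary relation on the words over some finite alphabet. -/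
structure WordRelation where
  Alphabet : Type
  finiteAlphabet : Finite Alphabet
  rel : Set (List Alphabet × List Alphabet)

/-- The language of all words `u # vʳᵉᵛ` with `(u, v) ∈ ρ`; the symbol `#` is `none`. -/
def unfolding {X : Type} (ρ : Set (List X × List X)) : Language (Option X) :=
  {w | ∃ u v : List X, (u, v) ∈ ρ ∧ w = u.map some ++ [none] ++ v.reverse.map some}

/-- The map from words over `(X ∪ {ε}) × (X ∪ {ε})` to pairs of words over `X`, concatenating
each of the two tracks; here `ε` is `none`. -/
def tapes {X : Type} (w : List (Option X × Option X)) : List X × List X :=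
  (w.filterMap Prod.fst, w.filterMap Prod.snd)

/-- `U(C)`: the relations whose unfolding is in `C`. -/
def unfoldedRelations (C : LanguageClass) : Set WordRelation :=
  {ρ | unfolding ρ.rel ∈ C (Option ρ.Alphabet)}

/-- `T(C)`: the relations that are the image under `tapes` of a language in `C`. -/
def twoTapeRelations (C : LanguageClass) : Set WordRelation :=
  {ρ | ∃ L ∈ C (Option ρ.Alphabet × Option ρ.Alphabet), ρ.rel = tapes '' L}

/-! ### Word problems -/

/-- The word problem of the monoid `M` with respect to generators `g x`, `x ∈ X`: the pairs of
words over `X` that represent the same element. -/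
def wordProblem {X M : Type} [Monoid M] (g : X → M) : Set (List X × List X) :=
  {p | (p.1.map g).prod = (p.2.map g).prod}

/-- The alphabet `{a, b, ℓ, r}`. -/
inductive Letter where
  | a
  | b
  | l
  | r

/-- The defining relations `ℓ aⁿ bⁿ r = ℓ bⁿ aⁿ r` (for `n = 0` the relation is trivial). -/
inductive M₁Rel : FreeMonoid Letter → FreeMonoid Letter → Prop
  | swap (n : ℕ) : M₁Rel
      (.of .l * .of .a ^ n * .of .b ^ n * .of .r) (.of .l * .of .b ^ n * .of .a ^ n * .of .r)

/-- The monoid presented by `⟨a, b, ℓ, r ∣ ℓ aⁿ bⁿ r = ℓ bⁿ aⁿ r (n ∈ ℕ)⟩`. -/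
abbrev M₁ : Type := PresentedMonoid M₁Rel

/-- The word problem of `M₁` with respect to `{a, b, ℓ, r}`. -/
def M₁WordProblem : WordRelation where
  Alphabet := Letter
  finiteAlphabet := Finite.of_surjective
    (fun i : Fin 4 => match i with | 0 => Letter.a | 1 => Letter.b | 2 => Letter.l | 3 => Letter.r)
    (fun x => match x with | .a => ⟨0, rfl⟩ | .b => ⟨1, rfl⟩ | .l => ⟨2, rfl⟩ | .r => ⟨3, rfl⟩)
  rel := wordProblem (PresentedMonoid.of M₁Rel)

/-! Inclusion. An accepting run on `u # vʳᵉᵛ` is cut right after `#`, at some configuration `(q,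
k)`. Its first part reads `u` from counter 0 up to `k`; its second part, run backwards, reads `v`
from counter 0 up to the same `k`. Both parts have to be followed by one counter. Each part splits,
by the last visits to the levels 0, 1, …, `k`, into paths that stay above one level and return to
it. The two parts are therefore simulated alternately, level by level, and move up to the next level
together. The common level is not stored: only the height above it is, with one bit telling whether
the level is zero (`SyncStep`, `exists_oneCounter_tapes_image`). Backward runs and synchronized runs
are not literally automata, so the argument uses the more symmetric `IsCounterSystem`, which
`IsCounterSystem.mem_oneCounterClass` turns back into automata.

The monoid `M₁`. Factors `ℓ aⁿ bⁿ r` and `ℓ bⁿ aⁿ r` of a word coincide or are disjoint, so equality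
in `M₁` is one round of independent swaps (`wordProblem_eq_exchange`). Reading both words in
parallel, a counter compares the two halves of each swapped block.

Non-membership. Context-free and one-counter languages both satisfy `HasInterchange`; proving it for
each separately avoids comparing the two classes, and yields strictness as well. The unfolded word
problem violates it: in `ℓ aⁿ bⁿ r # r aⁿ bⁿ ℓ`, a factor around `#` of length at most `n` has
essentially only letters `b` on the left and `a` on the right. Replacing it by a much longer such
factor spoils the balance of letters between the two sides, and so does changing the length of a
factor that avoids `#`. -/

/-! ### Paths in labelled transition systems -/

/-- `LabelledPath S c w d`: some finite sequence of moves of `S` leads from `c` to `d` and reads `w`. -/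
inductive LabelledPath {C A : Type} (S : C → Option A → C → Prop) : C → List A → C → Prop
  | refl (c : C) : LabelledPath S c [] c
  | step {c d e : C} {x : Option A} {w : List A} :
      S c x d → LabelledPath S d w e → LabelledPath S c (x.toList ++ w) e

namespace LabelledPath

variable {C A : Type} {S : C → Option A → C → Prop} {c d e : C} {u v w : List A}

theorem single {x : Option A} (h : S c x d) : LabelledPath S c x.toList d := by
  simpa using LabelledPath.step h (LabelledPath.refl d)

theorem trans (h : LabelledPath S c u d) (h' : LabelledPath S d v e) : LabelledPath S c (u ++ v) e := by
  induction h with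
  | refl c => exact h'
  | step hs _ ih => rw [List.append_assoc]; exact .step hs (ih h')

theorem snoc {x : Option A} (h : LabelledPath S c u d) (h' : S d x e) : LabelledPath S c (u ++ x.toList) e :=
  h.trans (single h')

theorem reverse (h : LabelledPath S c w d) : LabelledPath (fun c x d => S d x c) d w.reverse c := by
  induction h with
  | refl c => exact .refl c
  | @step c d e x w hs _ ih =>
    have := LabelledPath.snoc (S := fun c x d => S d x c) ih hs
    cases x <;> simpa using this

theorem of_map {B : Type} {g : B → A} {w : List B}
    (h : LabelledPath (fun c x d => S c (x.map g) d) c w d) : LabelledPath S c (w.map g) d := by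
  induction h with
  | refl c => exact .refl c
  | @step c d e x w hs _ ih =>
    have := LabelledPath.step hs ih
    cases x <;> simpa using this

theorem to_map {B : Type} {g : B → A} {w : List B} (h : LabelledPath S c (w.map g) d) :
    LabelledPath (fun c x d => S c (x.map g) d) c w d := by
  generalize hW : w.map g = W at h
  induction h generalizing w with
  | refl c => simp at hW; subst hW; exact .refl c
  | @step c d e x w' hs _ ih =>
    cases x with
    | none => exact LabelledPath.step (x := none) hs (ih (by simpa using hW))
    | some a =>
      cases w with
      | nil => simp at hW
      | cons b w =>
        simp at hW
        obtain ⟨rfl, hW⟩ := hW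
        exact LabelledPath.step (x := some b) hs (ih hW)

/-- Induction along a path from its last move. -/
theorem snoc_induction {P : List A → C → Prop} (h : LabelledPath S c w d) (refl : P [] c)
    (snoc : ∀ u d x e, LabelledPath S c u d → P u d → S d x e → P (u ++ x.toList) e) : P w d := by
  suffices ∀ c' w d, LabelledPath S c' w d → ∀ u, LabelledPath S c u c' → P u c' → P (u ++ w) d by
    simpa using this c w d h [] (.refl c) refl
  intro c' w d h
  induction h with
  | refl c' => intro u _ hu; simpa using hu
  | step hs _ ih =>
    intro u hp hu
    rw [← List.append_assoc]
    exact ih _ (hp.snoc hs) (snoc _ _ _ _ hp hu hs)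

end LabelledPath

theorem OneCounterAutomaton.run_iff_path {A : Type} (M : OneCounterAutomaton A)
    {c d : M.State × ℕ} {w : List A} : M.Run c w d ↔ LabelledPath M.Step c w d := by
  constructor <;> intro h
  · induction h with
    | refl c => exact .refl c
    | step hs _ ih => exact .step hs ih
  · induction h with
    | refl c => exact .refl c
    | step hs _ ih => exact .step hs ih

/-! ### Counter systems -/

/-- A transition relation on states with a counter that changes the counter by at most one and
only depends on whether the counter is zero before and after the move. -/
structure IsCounterSystem {Q A : Type} (S : Q × ℕ → Option A → Q × ℕ → Prop) : Prop where
  le_add_one : ∀ {p n x q m}, S (p, n) x (q, m) → n ≤ m + 1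
  le_add_one' : ∀ {p n x q m}, S (p, n) x (q, m) → m ≤ n + 1
  shift : ∀ p n x q m, S (p, n + 2) x (q, m + 2) ↔ S (p, n + 1) x (q, m + 1)

namespace IsCounterSystem

variable {Q A : Type} {S : Q × ℕ → Option A → Q × ℕ → Prop}

/-- The conditions are symmetric in source and target. This is the reason for letting moves depend
on whether the counter is zero afterwards: a reversed automaton tests for zero after its move. -/
theorem flip (hS : IsCounterSystem S) : IsCounterSystem fun c x d => S d x c where
  le_add_one h := hS.le_add_one' h
  le_add_one' h := hS.le_add_one h
  shift p n x q m := hS.shift q m x p n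

theorem shift_add (hS : IsCounterSystem S) (p n x q m) (k : ℕ) :
    S (p, n + k + 1) x (q, m + k + 1) ↔ S (p, n + 1) x (q, m + 1) := by
  induction k with
  | zero => rfl
  | succ k ih => rw [← ih]; exact hS.shift p (n + k) x q (m + k)

end IsCounterSystem

theorem OneCounterAutomaton.isCounterSystem_step {A : Type} (M : OneCounterAutomaton A) :
    IsCounterSystem M.Step where
  le_add_one h := by cases h <;> omega
  le_add_one' h := by cases h <;> omega
  shift p n x q m := by
    constructor <;> intro h
    · generalize hc : (p, n + 2) = c at h
      generalize hd : (q, m + 2) = d at h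
      cases h with
      | inc h =>
        simp at hc hd; obtain ⟨rfl, rfl⟩ := hc; obtain ⟨rfl, hd⟩ := hd
        obtain rfl : m = n + 1 := by omega
        exact .inc (by simpa using h)
      | keep h =>
        simp at hc hd; obtain ⟨rfl, rfl⟩ := hc; obtain ⟨rfl, hd⟩ := hd
        obtain rfl : m = n := by omega
        exact .keep (by simpa using h)
      | dec h =>
        simp at hc hd; obtain ⟨rfl, hc⟩ := hc; obtain ⟨rfl, hd⟩ := hd
        obtain rfl : n = m + 1 := by omega
        exact .dec h
    · generalize hc : (p, n + 1) = c at h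
      generalize hd : (q, m + 1) = d at h
      cases h with
      | inc h =>
        simp at hc hd; obtain ⟨rfl, rfl⟩ := hc; obtain ⟨rfl, hd⟩ := hd
        obtain rfl : m = n + 1 := by omega
        exact .inc (by simpa using h)
      | keep h =>
        simp at hc hd; obtain ⟨rfl, rfl⟩ := hc; obtain ⟨rfl, hd⟩ := hd
        obtain rfl : m = n := by omega
        exact .keep (by simpa using h)
      | dec h =>
        simp at hc hd; obtain ⟨rfl, hc⟩ := hc; obtain ⟨rfl, hd⟩ := hd
        obtain rfl : n = m + 1 := by omega
        exact .dec h

/-! ### The automaton of a counter system -/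

/-- The automaton simulating a counter system `S`. Its state includes a claim whether the counter
is zero, which is checked by the next move. -/
def counterAutomaton {Q A : Type} [Finite Q] (S : Q × ℕ → Option A → Q × ℕ → Prop)
    (I F : Set Q) : OneCounterAutomaton A where
  State := Option (Q × Bool)
  finiteState := inferInstance
  start := none
  accept := {s | ∃ q ∈ F, s = some (q, true)}
  trans
    | none, x, z, op, s => x = none ∧ z = true ∧ op = .keep ∧ ∃ q ∈ I, s = some (q, true)
    -- `(!z).toNat` is the representative 0 or 1 of the zero or positive counter values. Only after
    -- a decrement is it unknown whether the new value is zero, so `b'` is guessed.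
    | some (p, b), x, z, op, s => b = z ∧ ∃ q, match op with
      | .inc => s = some (q, false) ∧ S (p, (!z).toNat) x (q, (!z).toNat + 1)
      | .keep => s = some (q, z) ∧ S (p, (!z).toNat) x (q, (!z).toNat)
      | .dec => ∃ b', s = some (q, b') ∧ S (p, (!b').toNat + 1) x (q, (!b').toNat)

theorem counterAutomaton_step_of {Q A : Type} [Finite Q] {S : Q × ℕ → Option A → Q × ℕ → Prop}
    (hS : IsCounterSystem S) (I F : Set Q) {p q : Q} {n m : ℕ} {x : Option A}
    (h : S (p, n) x (q, m)) : (counterAutomaton S I F).Step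
      (some (p, decide (n = 0)), n) x (some (q, decide (m = 0)), m) := by
  have h1 := hS.le_add_one h
  have h2 := hS.le_add_one' h
  obtain rfl | rfl | rfl : m = n + 1 ∨ m = n ∨ n = m + 1 := by omega
  · refine .inc ⟨rfl, q, by simp, ?_⟩
    cases n with
    | zero => simpa using h
    | succ k => simpa using (hS.shift_add p 0 x q 1 k).1 (by convert h using 2 <;> simp; omega)
  · refine .keep ⟨rfl, q, rfl, ?_⟩
    cases m with
    | zero => simpa using h
    | succ k => simpa using (hS.shift_add p 0 x q 0 k).1 (by simpa using h)
  · refine .dec ⟨by simp, q, decide (m = 0), rfl, ?_⟩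
    cases m with
    | zero => simpa using h
    | succ k => simpa using (hS.shift_add p 1 x q 0 k).1 (by convert h using 2 <;> simp; omega)

/-- A wrong claim blocks the next move, and the claim in the final configuration is right; hence all
claims are right, by induction from the end of the path. -/
theorem path_of_counterAutomaton {Q A : Type} [Finite Q] {S : Q × ℕ → Option A → Q × ℕ → Prop}
    (hS : IsCounterSystem S) {I F : Set Q} {p q : Q} {b : Bool} {n : ℕ} {w : List A}
    (h : LabelledPath (counterAutomaton S I F).Step (some (p, b), n) w (some (q, true), 0)) :
    b = decide (n = 0) ∧ LabelledPath S (p, n) w (q, 0) := by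
  generalize hc : ((some (p, b), n) : (counterAutomaton S I F).State × ℕ) = c at h
  generalize hd : ((some (q, true), 0) : (counterAutomaton S I F).State × ℕ) = d at h
  induction h generalizing p b n with
  | refl c => subst hd; cases hc; exact ⟨rfl, .refl _⟩
  | step hs _ ih =>
    cases hs with
    | inc ht =>
      cases hc
      obtain ⟨hb, q', rfl, hst⟩ := ht
      refine ⟨hb, .step ?_ (ih rfl hd).2⟩
      cases n with
      | zero => simpa using hst
      | succ k =>
        have := (hS.shift_add p 0 _ q' 1 k).2 (by simpa using hst)
        convert this using 2 <;> simp; omega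
    | keep ht =>
      cases hc
      obtain ⟨hb, q', rfl, hst⟩ := ht
      refine ⟨hb, .step ?_ (ih rfl hd).2⟩
      cases n with
      | zero => simpa using hst
      | succ k => simpa using (hS.shift_add p 0 _ q' 0 k).2 (by simpa using hst)
    | @dec _ _ _ k ht =>
      cases hc
      obtain ⟨hb, q', b', rfl, hst⟩ := ht
      obtain ⟨rfl, hp⟩ := ih rfl hd
      refine ⟨by simpa using hb, .step ?_ hp⟩
      cases k with
      | zero => simpa using hst
      | succ k =>
        have := (hS.shift_add p 1 _ q' 0 k).2 (by simpa using hst)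
        convert this using 2 <;> simp; omega

/-- The language of a counter system is one-counter. -/
theorem IsCounterSystem.mem_oneCounterClass {Q A : Type} [Finite Q]
    {S : Q × ℕ → Option A → Q × ℕ → Prop} (hS : IsCounterSystem S) (I F : Set Q) :
    ({w | ∃ i ∈ I, ∃ f ∈ F, LabelledPath S (i, 0) w (f, 0)} : Language A) ∈ OneCounterClass A := by
  refine ⟨counterAutomaton S I F, ?_⟩
  ext w
  constructor
  · rintro ⟨_, ⟨q, hq, rfl⟩, h⟩
    rw [OneCounterAutomaton.run_iff_path] at h
    cases h with
    | step hs h =>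
      cases hs with
      | inc ht => simp [counterAutomaton] at ht
      | keep ht =>
        obtain ⟨rfl, -, -, i, hi, rfl⟩ := ht
        exact ⟨i, hi, q, hq, (path_of_counterAutomaton hS h).2⟩
  · rintro ⟨i, hi, f, hf, h⟩
    refine ⟨some (f, true), ⟨f, hf, rfl⟩, ?_⟩
    rw [OneCounterAutomaton.run_iff_path]
    refine LabelledPath.step (x := none) (.keep (q := some (i, true)) ⟨rfl, rfl, rfl, i, hi, rfl⟩) ?_
    have key : ∀ c w d, LabelledPath S c w d → LabelledPath (counterAutomaton S I F).Step
        (some (c.1, decide (c.2 = 0)), c.2) w (some (d.1, decide (d.2 = 0)), d.2) := by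
      intro c w d h
      induction h with
      | refl c => exact .refl _
      | step hs _ ih => exact .step (counterAutomaton_step_of hS I F hs) ih
    exact key _ _ _ h

/-! ### Two counters that agree at the end -/

/-- The counter system `S` restricted to counter values at least `k`, which are reduced by `k`. -/
def raised {Q A : Type} (S : Q × ℕ → Option A → Q × ℕ → Prop) (k : ℕ) :
    Q × ℕ → Option A → Q × ℕ → Prop :=
  fun c x d => S (c.1, c.2 + k) x (d.1, d.2 + k)

theorem IsCounterSystem.raised {Q A : Type} {S : Q × ℕ → Option A → Q × ℕ → Prop}
    (hS : IsCounterSystem S) (k : ℕ) : IsCounterSystem (raised S k) where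
  le_add_one h := by have := hS.le_add_one h; omega
  le_add_one' h := by have := hS.le_add_one' h; omega
  shift p n x q m := by
    have := hS.shift p (n + k) x q (m + k)
    simp only [_root_.raised]
    convert this using 3 <;> omega

/-- A path to a positive counter value splits at the last time the counter is zero. -/
theorem IsCounterSystem.exists_last_zero {Q A : Type} {S : Q × ℕ → Option A → Q × ℕ → Prop}
    (hS : IsCounterSystem S) {p q : Q} {m : ℕ} {w : List A}
    (h : LabelledPath S (p, 0) w (q, m + 1)) :
    ∃ p₁ p₂ u x v, w = u ++ (x.toList ++ v) ∧ LabelledPath S (p, 0) u (p₁, 0) ∧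
      S (p₁, 0) x (p₂, 1) ∧ LabelledPath (_root_.raised S 1) (p₂, 0) v (q, m) := by
  -- For the induction the path may start anywhere: either it never meets zero, or it splits as
  -- required.
  have key : ∀ c w d, LabelledPath S c w d → ∀ m, d.2 = m + 1 →
      (∃ n, c.2 = n + 1 ∧ LabelledPath (_root_.raised S 1) (c.1, n) w (d.1, m)) ∨
      ∃ p₁ p₂ u x v, w = u ++ (x.toList ++ v) ∧ LabelledPath S c u (p₁, 0) ∧
        S (p₁, 0) x (p₂, 1) ∧ LabelledPath (_root_.raised S 1) (p₂, 0) v (d.1, m) := by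
    intro c w d h
    induction h with
    | refl c => intro m hm; exact .inl ⟨m, hm, .refl _⟩
    | @step c d e x w hs _ ih =>
      intro m hm
      obtain ⟨n, hn, h⟩ | ⟨p₁, p₂, u, y, v, rfl, h₁, h₂, h₃⟩ := ih m hm
      · obtain ⟨p, k⟩ := c
        obtain ⟨q, l⟩ := d
        simp only at hn
        subst hn
        cases k with
        | zero =>
          obtain rfl : n = 0 := by have := hS.le_add_one' hs; omega
          exact .inr ⟨p, q, [], x, w, rfl, .refl _, hs, h⟩
        | succ k => exact .inl ⟨k, rfl, .step (S := _root_.raised S 1) (d := (q, n)) hs h⟩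
      · exact .inr ⟨p₁, p₂, x.toList ++ u, y, v, by simp, .step hs h₁, h₂, h₃⟩
  obtain ⟨n, hn, -⟩ | h := key _ _ _ h m rfl
  · simp at hn
  · exact h

/-- All positive base levels look alike, so the single bit `z` suffices to remember the base. -/
theorem IsCounterSystem.raised_raised_one {Q A : Type} {S : Q × ℕ → Option A → Q × ℕ → Prop}
    (hS : IsCounterSystem S) (z : Bool) :
    _root_.raised (_root_.raised S (!z).toNat) 1 = _root_.raised S 1 := by
  cases z
  · funext c x d
    exact propext (hS.shift c.1 c.2 x d.1 d.2)
  · rfl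

section Synchronization

variable {Q₁ Q₂ A : Type}

theorem tapes_append (u v : List (Option A × Option A)) :
    tapes (u ++ v) = ((tapes u).1 ++ (tapes v).1, (tapes u).2 ++ (tapes v).2) := by
  simp [tapes]

theorem tapes_nil : tapes ([] : List (Option A × Option A)) = ([], []) := rfl

theorem tapes_cons (x y : Option A) (w : List (Option A × Option A)) :
    tapes ((x, y) :: w) = (x.toList ++ (tapes w).1, y.toList ++ (tapes w).2) := by
  cases x <;> cases y <;> rfl

/-- A state of the synchronization of two counter systems. -/
structure SyncState (Q₁ Q₂ : Type) where
  fst : Q₁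
  snd : Q₂
  /-- whether the second system is being simulated -/
  second : Bool
  /-- whether both systems are at counter value zero when the simulating counter is zero -/
  ground : Bool

instance [Finite Q₁] [Finite Q₂] : Finite (SyncState Q₁ Q₂) :=
  Finite.of_injective
    (fun s : SyncState Q₁ Q₂ => (s.fst, s.snd, s.second, s.ground)) (by
      rintro ⟨⟩ ⟨⟩ h; simpa using h)

/-- The synchronization of two counter systems. Both systems start from a common counter value
that is not stored; the counter holds the difference to this base value of the system that is being
simulated. When both systems are at the base value, they can increase it together. -/
inductive SyncStep (S₁ : Q₁ × ℕ → Option A → Q₁ × ℕ → Prop)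
    (S₂ : Q₂ × ℕ → Option A → Q₂ × ℕ → Prop) : SyncState Q₁ Q₂ × ℕ →
      Option (Option A × Option A) → SyncState Q₁ Q₂ × ℕ → Prop
  | fst {p p' q z n n' x} : raised S₁ (!z).toNat (p, n) x (p', n') →
      SyncStep S₁ S₂ (⟨p, q, false, z⟩, n) (some (x, none)) (⟨p', q, false, z⟩, n')
  | switch {p q z} : SyncStep S₁ S₂ (⟨p, q, false, z⟩, 0) none (⟨p, q, true, z⟩, 0)
  | snd {p q q' z n n' y} : raised S₂ (!z).toNat (q, n) y (q', n') →
      SyncStep S₁ S₂ (⟨p, q, true, z⟩, n) (some (none, y)) (⟨p, q', true, z⟩, n')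
  | up {p p' q q' z x y} : raised S₁ (!z).toNat (p, 0) x (p', 1) →
      raised S₂ (!z).toNat (q, 0) y (q', 1) →
      SyncStep S₁ S₂ (⟨p, q, true, z⟩, 0) (some (x, y)) (⟨p', q', false, false⟩, 0)

variable {S₁ : Q₁ × ℕ → Option A → Q₁ × ℕ → Prop} {S₂ : Q₂ × ℕ → Option A → Q₂ × ℕ → Prop}

theorem isCounterSystem_syncStep (h₁ : IsCounterSystem S₁) (h₂ : IsCounterSystem S₂) :
    IsCounterSystem (SyncStep S₁ S₂) where
  le_add_one h := by
    cases h with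
    | fst h => exact (h₁.raised _).le_add_one h
    | snd h => exact (h₂.raised _).le_add_one h
    | switch => omega
    | up => omega
  le_add_one' h := by
    cases h with
    | fst h => exact (h₁.raised _).le_add_one' h
    | snd h => exact (h₂.raised _).le_add_one' h
    | switch => omega
    | up => omega
  shift s n x t m := by
    constructor <;> intro h
    · cases h with
      | fst h => exact .fst (((h₁.raised _).shift ..).1 h)
      | snd h => exact .snd (((h₂.raised _).shift ..).1 h)
    · cases h with
      | fst h => exact .fst (((h₁.raised _).shift ..).2 h)
      | snd h => exact .snd (((h₂.raised _).shift ..).2 h)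

theorem SyncStep.exists_path_fst {p p' : Q₁} {q : Q₂} {z : Bool} {n n' : ℕ} {u : List A}
    (h : LabelledPath (raised S₁ (!z).toNat) (p, n) u (p', n')) :
    ∃ w, tapes w = (u, []) ∧
      LabelledPath (SyncStep S₁ S₂) (⟨p, q, false, z⟩, n) w (⟨p', q, false, z⟩, n') := by
  suffices ∀ c u d, LabelledPath (raised S₁ (!z).toNat) c u d → ∃ w, tapes w = (u, []) ∧
      LabelledPath (SyncStep S₁ S₂) (⟨c.1, q, false, z⟩, c.2) w (⟨d.1, q, false, z⟩, d.2) from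
    this _ _ _ h
  intro c u d h
  induction h with
  | refl c => exact ⟨[], rfl, .refl _⟩
  | @step c d e x u hs _ ih =>
    obtain ⟨w, hw, h⟩ := ih
    refine ⟨(x, none) :: w, ?_, .step (x := some (x, none)) (.fst hs) h⟩
    simp [tapes_cons, hw]

theorem SyncStep.exists_path_snd {p : Q₁} {q q' : Q₂} {z : Bool} {n n' : ℕ} {v : List A}
    (h : LabelledPath (raised S₂ (!z).toNat) (q, n) v (q', n')) :
    ∃ w, tapes w = ([], v) ∧
      LabelledPath (SyncStep S₁ S₂) (⟨p, q, true, z⟩, n) w (⟨p, q', true, z⟩, n') := by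
  suffices ∀ c v d, LabelledPath (raised S₂ (!z).toNat) c v d → ∃ w, tapes w = ([], v) ∧
      LabelledPath (SyncStep S₁ S₂) (⟨p, c.1, true, z⟩, c.2) w (⟨p, d.1, true, z⟩, d.2) from
    this _ _ _ h
  intro c v d h
  induction h with
  | refl c => exact ⟨[], rfl, .refl _⟩
  | @step c d e y u hs _ ih =>
    obtain ⟨w, hw, h⟩ := ih
    refine ⟨(none, y) :: w, ?_, .step (x := some (none, y)) (.snd hs) h⟩
    simp [tapes_cons, hw]

/-- Induction on the common final height `k`. Both paths are cut at their last visit to the base;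
the parts before are simulated one after the other, the two moves leaving the base become a single
`up`, and the rest starts at a base one higher. -/
theorem SyncStep.exists_path (h₁ : IsCounterSystem S₁) (h₂ : IsCounterSystem S₂)
    {p p' : Q₁} {q q' : Q₂} {z : Bool} {k : ℕ} {u v : List A}
    (hu : LabelledPath (raised S₁ (!z).toNat) (p, 0) u (p', k))
    (hv : LabelledPath (raised S₂ (!z).toNat) (q, 0) v (q', k)) :
    ∃ w z', tapes w = (u, v) ∧
      LabelledPath (SyncStep S₁ S₂) (⟨p, q, false, z⟩, 0) w (⟨p', q', true, z'⟩, 0) := by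
  induction k generalizing p q z u v with
  | zero =>
    obtain ⟨w₁, hw₁, hp₁⟩ := exists_path_fst (S₂ := S₂) (q := q) hu
    obtain ⟨w₂, hw₂, hp₂⟩ := exists_path_snd (S₁ := S₁) (p := p') hv
    refine ⟨w₁ ++ w₂, z, ?_, hp₁.trans (.step (x := none) .switch hp₂)⟩
    simp [tapes_append, hw₁, hw₂]
  | succ k ih =>
    obtain ⟨p₁, p₂, u₁, x, u₂, rfl, hu₁, hx, hu₂⟩ := (h₁.raised _).exists_last_zero hu
    obtain ⟨q₁, q₂, v₁, y, v₂, rfl, hv₁, hy, hv₂⟩ := (h₂.raised _).exists_last_zero hv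
    rw [h₁.raised_raised_one] at hu₂
    rw [h₂.raised_raised_one] at hv₂
    obtain ⟨w₁, hw₁, hp₁⟩ := exists_path_fst (S₂ := S₂) (q := q) hu₁
    obtain ⟨w₂, hw₂, hp₂⟩ := exists_path_snd (S₁ := S₁) (p := p₁) hv₁
    obtain ⟨w, z', hw, hp⟩ := ih (z := false) hu₂ hv₂
    refine ⟨w₁ ++ (w₂ ++ (x, y) :: w), z', ?_,
      hp₁.trans (.step (x := none) .switch (hp₂.trans (.step (x := some (x, y)) (.up hx hy) hp)))⟩
    simp [tapes_append, tapes_cons, hw₁, hw₂, hw]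

theorem raised_iff_of_ground {Q : Type} {S : Q × ℕ → Option A → Q × ℕ → Prop}
    (hS : IsCounterSystem S) {z : Bool} {k : ℕ} (hz : z = decide (k = 0)) {p p' : Q} {n n' : ℕ}
    {x : Option A} :
    raised S (!z).toNat (p, n) x (p', n') ↔ S (p, k + n) x (p', k + n') := by
  subst hz
  cases k with
  | zero => simp [raised]
  | succ k =>
    have := hS.shift_add p n x p' n' k
    have e : ∀ j, k + 1 + j = j + k + 1 := by omega
    simpa [raised, e] using this.symm

/-- The invariant recovers the base value `k` that the simulation does not store: the system not
being simulated rests at `k`, the other one is at `k + n`. -/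
theorem SyncStep.exists_base (h₁ : IsCounterSystem S₁) (h₂ : IsCounterSystem S₂)
    {p p' : Q₁} {q q' : Q₂} {b z : Bool} {n : ℕ} {w : List (Option A × Option A)}
    (h : LabelledPath (SyncStep S₁ S₂) (⟨p, q, false, true⟩, 0) w (⟨p', q', b, z⟩, n)) :
    ∃ k, z = decide (k = 0) ∧
      LabelledPath S₁ (p, 0) (tapes w).1 (p', k + if b then 0 else n) ∧
      LabelledPath S₂ (q, 0) (tapes w).2 (q', k + if b then n else 0) := by
  let P (w : List (Option A × Option A)) (c : SyncState Q₁ Q₂ × ℕ) : Prop :=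
    ∃ k, c.1.ground = decide (k = 0) ∧
      LabelledPath S₁ (p, 0) (tapes w).1 (c.1.fst, k + if c.1.second then 0 else c.2) ∧
      LabelledPath S₂ (q, 0) (tapes w).2 (c.1.snd, k + if c.1.second then c.2 else 0)
  suffices H : P w (⟨p', q', b, z⟩, n) from H
  refine h.snoc_induction ⟨0, rfl, .refl _, .refl _⟩ ?_
  rintro w c x d - ⟨k, hk, hu, hv⟩ hs
  cases hs with
  | fst hs =>
    refine ⟨k, hk, ?_, ?_⟩
    · simpa [tapes_append, tapes_cons, tapes_nil] using
        hu.snoc ((raised_iff_of_ground h₁ hk).1 hs)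
    · simpa [tapes_append, tapes_cons, tapes_nil] using hv
  | switch => exact ⟨k, hk, by simpa using hu, by simpa using hv⟩
  | snd hs =>
    refine ⟨k, hk, ?_, ?_⟩
    · simpa [tapes_append, tapes_cons, tapes_nil] using hu
    · simpa [tapes_append, tapes_cons, tapes_nil] using
        hv.snoc ((raised_iff_of_ground h₂ hk).1 hs)
  | up hs₁ hs₂ =>
    refine ⟨k + 1, by simp, ?_, ?_⟩
    · simpa [tapes_append, tapes_cons, tapes_nil] using
        hu.snoc ((raised_iff_of_ground h₁ hk).1 hs₁)
    · simpa [tapes_append, tapes_cons, tapes_nil] using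
        hv.snoc ((raised_iff_of_ground h₂ hk).1 hs₂)

/-- Pairs of words read by two counter systems that start with counter zero and end with equal
counters form a relation that is the image under `tapes` of a one-counter language. -/
theorem exists_oneCounter_tapes_image [Finite Q₁] [Finite Q₂] (h₁ : IsCounterSystem S₁)
    (h₂ : IsCounterSystem S₂) (I F : Set (Q₁ × Q₂)) :
    ∃ L ∈ OneCounterClass (Option A × Option A),
      {r : List A × List A | ∃ i ∈ I, ∃ f ∈ F, ∃ k, LabelledPath S₁ (i.1, 0) r.1 (f.1, k) ∧
        LabelledPath S₂ (i.2, 0) r.2 (f.2, k)} = tapes '' L := by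
  refine ⟨_, (isCounterSystem_syncStep h₁ h₂).mem_oneCounterClass
    {s | (s.fst, s.snd) ∈ I ∧ s.second = false ∧ s.ground = true}
    {s | (s.fst, s.snd) ∈ F ∧ s.second = true}, ?_⟩
  ext ⟨u, v⟩
  constructor
  · rintro ⟨⟨p, q⟩, hi, ⟨p', q'⟩, hf, k, hu, hv⟩
    obtain ⟨w, z', hw, hp⟩ := SyncStep.exists_path h₁ h₂ (z := true) hu hv
    exact ⟨w, ⟨_, ⟨hi, rfl, rfl⟩, _, ⟨hf, rfl⟩, hp⟩, hw⟩
  · rintro ⟨w, ⟨⟨p, q, b, z⟩, ⟨hi, hb, hz⟩, ⟨p', q', b', z'⟩, ⟨hf, hb'⟩, hp⟩, hw⟩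
    dsimp only at hi hb hz hf hb'
    subst hb hz hb'
    obtain ⟨k, -, hu, hv⟩ := SyncStep.exists_base h₁ h₂ hp
    rw [hw] at hu hv
    exact ⟨_, hi, _, hf, k, by simpa using hu, by simpa using hv⟩

end Synchronization

/-! ### Unfoldings recognized by one-counter automata -/

/-- The moves of `M` up to the first occurrence of the symbol `none`, which is treated as a move
without input and recorded in the state. -/
inductive MarkerStep {X : Type} (M : OneCounterAutomaton (Option X)) :
    (M.State × Bool) × ℕ → Option X → (M.State × Bool) × ℕ → Prop
  | letter {p q n m x} : M.Step (p, n) (x.map some) (q, m) →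
      MarkerStep M ((p, false), n) x ((q, false), m)
  | marker {p q n m} : M.Step (p, n) (some none) (q, m) →
      MarkerStep M ((p, false), n) none ((q, true), m)

theorem isCounterSystem_markerStep {X : Type} (M : OneCounterAutomaton (Option X)) :
    IsCounterSystem (MarkerStep M) where
  le_add_one h := by cases h with
    | letter h => exact M.isCounterSystem_step.le_add_one h
    | marker h => exact M.isCounterSystem_step.le_add_one h
  le_add_one' h := by cases h with
    | letter h => exact M.isCounterSystem_step.le_add_one' h
    | marker h => exact M.isCounterSystem_step.le_add_one' h
  shift p n x q m := by
    constructor <;> intro h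
    · cases h with
      | letter h => exact .letter ((M.isCounterSystem_step.shift ..).1 h)
      | marker h => exact .marker ((M.isCounterSystem_step.shift ..).1 h)
    · cases h with
      | letter h => exact .letter ((M.isCounterSystem_step.shift ..).2 h)
      | marker h => exact .marker ((M.isCounterSystem_step.shift ..).2 h)

theorem path_append_none_cons_iff {X : Type} (M : OneCounterAutomaton (Option X))
    {p q : M.State} {n m : ℕ} {u : List X} {v : List (Option X)} :
    LabelledPath M.Step (p, n) (u.map some ++ none :: v) (q, m) ↔
      ∃ q' m', LabelledPath (MarkerStep M) ((p, false), n) u ((q', true), m') ∧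
        LabelledPath M.Step (q', m') v (q, m) := by
  constructor
  · suffices H : ∀ c W d, LabelledPath M.Step c W d → ∀ u : List X, W = u.map some ++ none :: v →
        ∃ q' m', LabelledPath (MarkerStep M) ((c.1, false), c.2) u ((q', true), m') ∧
          LabelledPath M.Step (q', m') v d from fun h => H _ _ _ h u rfl
    intro c W d h
    induction h with
    | refl c => intro u hu; simp at hu
    | @step c d e x w hs h ih =>
      intro u hu
      match x, u with
      | none, u =>
        obtain ⟨q', m', h₁, h₂⟩ := ih u (by simpa using hu)
        exact ⟨q', m', .step (x := none) (.letter hs) h₁, h₂⟩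
      | some x, [] =>
        simp at hu
        obtain ⟨rfl, rfl⟩ := hu
        exact ⟨d.1, d.2, .step (x := none) (.marker hs) (.refl _), h⟩
      | some x, a :: u =>
        simp at hu
        obtain ⟨rfl, hu⟩ := hu
        obtain ⟨q', m', h₁, h₂⟩ := ih u hu
        exact ⟨q', m', .step (x := some a) (.letter hs) h₁, h₂⟩
  · rintro ⟨q', m', h₁, h₂⟩
    -- No move leaves a state in which the marker has been recorded, so a path from such a state is
    -- trivial.
    suffices H : ∀ c u d, LabelledPath (MarkerStep M) c u d → d = ((q', true), m') →
        (c.1.2 = true → u = [] ∧ c = d) ∧ (c.1.2 = false →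
        LabelledPath M.Step (c.1.1, c.2) (u.map some ++ none :: v) (q, m)) from
      (H _ _ _ h₁ rfl).2 rfl
    intro c u d h
    induction h with
    | refl c => rintro rfl; simp
    | @step c d e x w hs _ ih =>
      intro he
      cases hs with
      | letter hs => refine ⟨by simp, fun _ => ?_⟩; cases x <;> exact .step hs ((ih he).2 rfl)
      | marker hs =>
        obtain ⟨rfl, rfl⟩ := (ih he).1 rfl
        cases he
        exact ⟨by simp, fun _ => .step hs h₂⟩

theorem unfoldedRelations_subset_twoTapeRelations :
    unfoldedRelations OneCounterClass ⊆ twoTapeRelations OneCounterClass := by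
  rintro ⟨X, hX, ρ⟩ ⟨M, hM⟩
  have := M.finiteState
  -- After the marker only moves over `X` occur. Reversing this system turns reading `v.reverse`
  -- into reading `v`, starting from an accepting state with counter 0.
  have hS : IsCounterSystem fun (c : M.State × ℕ) (x : Option X) d => M.Step c (x.map some) d :=
    ⟨M.isCounterSystem_step.le_add_one, M.isCounterSystem_step.le_add_one',
      fun p n x q m => M.isCounterSystem_step.shift p n _ q m⟩
  obtain ⟨L, hL, h⟩ := exists_oneCounter_tapes_image (isCounterSystem_markerStep M) hS.flip
    {i | i.1 = (M.start, false) ∧ i.2 ∈ M.accept} {f | f.1 = (f.2, true)}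
  refine ⟨L, hL, Eq.trans ?_ h⟩
  ext ⟨u, v⟩
  have huv : (u, v) ∈ ρ ↔ u.map some ++ none :: (v.reverse.map some) ∈ M.language := by
    rw [hM]
    constructor
    · intro h
      exact ⟨u, v, h, by simp⟩
    · rintro ⟨u', v', h, e⟩
      rw [List.append_assoc, List.singleton_append,
        List.append_cons_inj_of_notMem (by simp) (by simp)] at e
      obtain ⟨hu, -, hv⟩ := e
      rw [List.map_inj_right fun _ _ => Option.some.inj] at hu hv
      rw [List.reverse_inj] at hv
      subst hu hv
      exact h
  refine huv.trans ?_
  constructor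
  · rintro ⟨f, hf, h⟩
    rw [M.run_iff_path, path_append_none_cons_iff] at h
    obtain ⟨q, k, h₁, h₂⟩ := h
    refine ⟨((M.start, false), f), ⟨rfl, hf⟩, ((q, true), q), rfl, k, h₁, ?_⟩
    simpa using h₂.to_map.reverse
  · rintro ⟨⟨i, f⟩, ⟨hi, hf⟩, ⟨q', q⟩, hq, k, h₁, h₂⟩
    dsimp only at hi hf hq
    subst hi
    obtain rfl : q' = (q, true) := hq
    refine ⟨f, hf, ?_⟩
    rw [M.run_iff_path, path_append_none_cons_iff]
    exact ⟨_, _, h₁, h₂.reverse.of_map⟩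

/-! ### The word problem of `M₁` -/

/-- The letters `a` and `b`. -/
def Letter.ofBool : Bool → Letter
  | true => .a
  | false => .b

theorem Letter.ofBool_ne_l (o : Bool) : Letter.ofBool o ≠ .l := by
  cases o <;> simp [Letter.ofBool]

theorem Letter.ofBool_ne_r (o : Bool) : Letter.ofBool o ≠ .r := by
  cases o <;> simp [Letter.ofBool]

theorem List.append_cons_inj_of_notMem_of_notMem {A : Type} {a : A} {u v u' v' : List A}
    (hu : a ∉ u) (hu' : a ∉ u') (h : u ++ a :: v = u' ++ a :: v') : u = u' ∧ v = v' := by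
  induction u generalizing u' with
  | nil =>
    cases u' with
    | nil => exact ⟨rfl, List.tail_eq_of_cons_eq h⟩
    | cons b u' => exact absurd (List.mem_cons.2 (.inl (List.head_eq_of_cons_eq h))) hu'
  | cons b u ih =>
    cases u' with
    | nil => exact absurd (List.mem_cons.2 (.inl (List.head_eq_of_cons_eq h).symm)) hu
    | cons c u' =>
      rw [List.mem_cons, not_or] at hu hu'
      rw [List.cons_append, List.cons_append, List.cons.injEq] at h
      obtain ⟨rfl, rfl⟩ := ih hu.2 hu'.2 h.2
      exact ⟨by rw [h.1], rfl⟩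

/-- The pairs of words obtained by independent applications of the defining relations of `M₁`
to disjoint factors. -/
inductive Exchange : List Letter → List Letter → Prop
  | nil : Exchange [] []
  | cons (x : Letter) {u v : List Letter} : Exchange u v → Exchange (x :: u) (x :: v)
  | swap (o : Bool) (n : ℕ) {u v : List Letter} : Exchange u v →
      Exchange
        (.l :: (List.replicate n (.ofBool o) ++ (List.replicate n (.ofBool !o) ++ .r :: u)))
        (.l :: (List.replicate n (.ofBool !o) ++ (List.replicate n (.ofBool o) ++ .r :: v)))

namespace Exchange

theorem refl (u : List Letter) : Exchange u u := by
  induction u with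
  | nil => exact .nil
  | cons x u ih => exact .cons x ih

theorem symm {u v : List Letter} (h : Exchange u v) : Exchange v u := by
  induction h with
  | nil => exact .nil
  | cons x _ ih => exact .cons x ih
  | swap o n _ ih => simpa using Exchange.swap (!o) n ih

theorem append {u v u' v' : List Letter} (h : Exchange u v) (h' : Exchange u' v') :
    Exchange (u ++ u') (v ++ v') := by
  induction h with
  | nil => exact h'
  | cons x _ ih => exact .cons x ih
  | swap o n _ ih => simpa using Exchange.swap o n ih

theorem append_left (s : List Letter) {u v : List Letter} (h : Exchange u v) :
    Exchange (s ++ u) (s ++ v) :=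
  (refl s).append h

theorem perm {u v : List Letter} (h : Exchange u v) : u.Perm v := by
  induction h with
  | nil => exact .nil
  | cons x _ ih => exact .cons x ih
  | swap o n _ ih =>
    simp only [← List.append_assoc]
    exact .cons _ (List.perm_append_comm.append (.cons _ ih))

/-- Every swapped block begins with `l`, so no swap starts at another letter. -/
theorem exists_of_cons {x : Letter} (hx : x ≠ .l) {u v : List Letter}
    (h : Exchange (x :: u) v) : ∃ v', v = x :: v' ∧ Exchange u v' := by
  cases h with
  | cons _ h => exact ⟨_, rfl, h⟩
  | swap => exact absurd rfl hx

theorem exists_of_replicate {x : Letter} (hx : x ≠ .l) {n : ℕ} {u v : List Letter}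
    (h : Exchange (List.replicate n x ++ u) v) :
    ∃ v', v = List.replicate n x ++ v' ∧ Exchange u v' := by
  induction n generalizing v with
  | zero => exact ⟨v, rfl, h⟩
  | succ n ih =>
    obtain ⟨v', rfl, h₁⟩ := exists_of_cons hx h
    obtain ⟨v'', rfl, h₂⟩ := ih h₁
    exact ⟨v'', rfl, h₂⟩

/-- Exchanges do not affect a leading factor `aⁿ bⁿ r` or `bⁿ aⁿ r`. -/
theorem exists_of_block {o : Bool} {n : ℕ} {u v : List Letter}
    (h : Exchange (List.replicate n (.ofBool o) ++ (List.replicate n (.ofBool !o) ++ .r :: u)) v) :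
    ∃ v', v = List.replicate n (.ofBool o) ++ (List.replicate n (.ofBool !o) ++ .r :: v') ∧
      Exchange u v' := by
  obtain ⟨v, rfl, h₁⟩ := exists_of_replicate (Letter.ofBool_ne_l _) h
  obtain ⟨v, rfl, h₂⟩ := exists_of_replicate (Letter.ofBool_ne_l _) h₁
  obtain ⟨v, rfl, h₃⟩ := exists_of_cons (by simp) h₂
  exact ⟨v, rfl, h₃⟩

theorem replicate_ofBool_inj {o o' : Bool} {n m : ℕ} {u v : List Letter}
    (h : List.replicate n (Letter.ofBool o) ++ (List.replicate n (.ofBool !o) ++ .r :: u) =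
      List.replicate m (Letter.ofBool o') ++ (List.replicate m (.ofBool !o') ++ .r :: v)) :
    n = m ∧ (n = 0 ∨ o = o') ∧ u = v := by
  rw [← List.append_assoc, ← List.append_assoc] at h
  have hr (o : Bool) : Letter.r ≠ .ofBool o := (Letter.ofBool_ne_r o).symm
  obtain ⟨h', rfl⟩ := List.append_cons_inj_of_notMem_of_notMem
    (by simp [List.mem_replicate, hr]) (by simp [List.mem_replicate, hr]) h
  obtain rfl : n = m := by have := congrArg List.length h'; simp at this; omega
  refine ⟨rfl, ?_, rfl⟩
  have := (List.append_inj h' (by simp)).1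
  rw [List.replicate_inj] at this
  exact this.2.imp_right fun h => by cases o <;> cases o' <;> simp_all [Letter.ofBool]

/-- A block contains `l` only as its first letter. Blocks swapped by the two exchanges thus start at
different letters `l` and are disjoint, or start at the same one and are equal. -/
theorem trans {u v w : List Letter} (h : Exchange u v) (h' : Exchange v w) : Exchange u w := by
  induction h generalizing w with
  | nil => exact h'
  | cons x h ih =>
    cases h' with
    | cons _ h' => exact .cons x (ih h')
    | swap o n h' =>
      obtain ⟨u', rfl, h''⟩ := exists_of_block h.symm
      -- The induction hypothesis concerns the whole tail after `l`, so the second exchange is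
      -- applied behind the unswapped block, which is then split off again.
      have := ih (append_left _ (append_left _ (.cons _ h')))
      obtain ⟨w', hw, h'''⟩ := exists_of_block this
      simp only [List.append_cancel_left_eq, List.cons.injEq, true_and] at hw
      subst hw
      exact .swap o n h'''
  | @swap o n u v h ih =>
    generalize hv : (.l :: (List.replicate n (.ofBool !o) ++ (List.replicate n (.ofBool o) ++
      .r :: v)) : List Letter) = v₀ at h'
    cases h' with
    | nil => simp at hv
    | cons _ h' =>
      simp at hv
      obtain ⟨rfl, rfl⟩ := hv
      obtain ⟨w, rfl, h''⟩ := exists_of_block (o := !o) (by simpa using h')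
      simpa using Exchange.swap o n (ih h'')
    | @swap o' m u' w h' =>
      simp only [List.cons.injEq, true_and] at hv
      obtain ⟨rfl, ho, rfl⟩ := replicate_ofBool_inj (o := !o) (by simpa using hv)
      -- The second swap undoes the first. For `n = 0` the orientation is undetermined, but the
      -- block is just `l r`.
      obtain rfl | rfl := ho
      · exact .cons _ (.cons _ (ih h'))
      · simpa using .cons _ (append_left _ (append_left _ (.cons _ (ih h'))))

/-- `Exchange` as a congruence. -/
def con : Con (FreeMonoid Letter) where
  r u v := Exchange u.toList v.toList
  iseqv := ⟨fun u => refl _, symm, trans⟩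
  mul' h h' := by simpa using h.append h'

end Exchange

theorem wordProblem_eq_exchange :
    wordProblem (PresentedMonoid.of M₁Rel) = {p | Exchange p.1 p.2} := by
  have hof (u : List Letter) : (u.map (PresentedMonoid.of M₁Rel)).prod =
      PresentedMonoid.mk M₁Rel (FreeMonoid.ofList u) := by
    induction u with
    | nil => rfl
    | cons x u ih =>
      rw [List.map_cons, List.prod_cons, ih, FreeMonoid.ofList_cons, map_mul]
      rfl
  have hpow (x : Letter) (n : ℕ) : (FreeMonoid.of x ^ n).toList = List.replicate n x := by
    induction n with
    | zero => rfl
    | succ n ih => rw [pow_succ', FreeMonoid.toList_mul, ih]; rfl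
  ext ⟨u, v⟩
  simp only [wordProblem, hof, Set.mem_ofPred_eq]
  constructor
  · intro h
    rw [PresentedMonoid.mk_eq_mk_iff] at h
    have hle : conGen M₁Rel ≤ Exchange.con := by
      rw [Con.conGen_le]
      rintro _ _ ⟨n⟩
      have := Exchange.swap true n .nil
      simpa [Exchange.con, hpow, Letter.ofBool] using this
    exact hle h
  · intro h
    have hmul (x : Letter) (u v : List Letter) (h : PresentedMonoid.mk M₁Rel (.ofList u) =
        PresentedMonoid.mk M₁Rel (.ofList v)) : PresentedMonoid.mk M₁Rel (.ofList (x :: u)) =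
        PresentedMonoid.mk M₁Rel (.ofList (x :: v)) := by
      rw [FreeMonoid.ofList_cons, FreeMonoid.ofList_cons, map_mul, map_mul, h]
    have hswap (n : ℕ) (u v : List Letter) (h : PresentedMonoid.mk M₁Rel (.ofList u) =
        PresentedMonoid.mk M₁Rel (.ofList v)) :
        PresentedMonoid.mk M₁Rel (.ofList (.l :: (List.replicate n .a ++
          (List.replicate n .b ++ .r :: u)))) =
        PresentedMonoid.mk M₁Rel (.ofList (.l :: (List.replicate n .b ++
          (List.replicate n .a ++ .r :: v)))) := by
      have key := PresentedMonoid.mk_eq_mk_of_rel (M₁Rel.swap n)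
      have := congrArg₂ (· * ·) key h
      simp only [← map_mul] at this
      convert this using 2 <;> apply FreeMonoid.toList.injective <;> simp [hpow]
    induction h with
    | nil => rfl
    | cons x _ ih => exact hmul x _ _ ih
    | swap o n _ ih =>
      cases o
      · exact (hswap n _ _ ih.symm).symm
      · exact hswap n _ _ ih

/-- The states of an automaton for the pairs in `Exchange`. -/
inductive ExchangeState where
  | idle
  | up (o : Bool)
  | down (o : Bool)

instance : Finite ExchangeState :=
  Finite.of_injective (fun s : ExchangeState => match s with
    | .idle => (none : Option (Bool × Bool))
    | .up o => some (true, o)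
    | .down o => some (false, o)) (by rintro (_ | _ | _) (_ | _ | _) h <;> simp_all)

/-- The moves of a counter system that reads the pairs in `Exchange` letter by letter. -/
inductive ExchangeStep : ExchangeState × ℕ → Option (Option Letter × Option Letter) →
    ExchangeState × ℕ → Prop
  | letter (x : Letter) : ExchangeStep (.idle, 0) (some (some x, some x)) (.idle, 0)
  | start (o : Bool) : ExchangeStep (.idle, 0) (some (some .l, some .l)) (.up o, 0)
  | up (o : Bool) (n : ℕ) :
      ExchangeStep (.up o, n) (some (some (.ofBool o), some (.ofBool !o))) (.up o, n + 1)
  | turn (o : Bool) (n : ℕ) : ExchangeStep (.up o, n) none (.down o, n)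
  | down (o : Bool) (n : ℕ) :
      ExchangeStep (.down o, n + 1) (some (some (.ofBool !o), some (.ofBool o))) (.down o, n)
  | finish (o : Bool) : ExchangeStep (.down o, 0) (some (some .r, some .r)) (.idle, 0)

theorem isCounterSystem_exchangeStep : IsCounterSystem ExchangeStep where
  le_add_one h := by cases h <;> omega
  le_add_one' h := by cases h <;> omega
  shift p n x q m := by
    constructor <;> intro h <;> cases h <;> constructor

theorem ExchangeStep.path_up (o : Bool) (n k : ℕ) :
    LabelledPath ExchangeStep (.up o, k)
      (List.replicate n (some (.ofBool o), some (.ofBool !o))) (.up o, k + n) := by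
  induction n generalizing k with
  | zero => exact .refl _
  | succ n ih =>
    have := ih (k + 1)
    rw [add_right_comm, add_assoc] at this
    exact .step (x := some _) (.up o k) this

theorem ExchangeStep.path_down (o : Bool) (n : ℕ) :
    LabelledPath ExchangeStep (.down o, n)
      (List.replicate n (some (.ofBool !o), some (.ofBool o))) (.down o, 0) := by
  induction n with
  | zero => exact .refl _
  | succ n ih => exact .step (x := some _) (.down o n) ih

theorem tapes_replicate (x y : Letter) (n : ℕ) :
    tapes (List.replicate n (some x, some y)) = (List.replicate n x, List.replicate n y) := by
  simp [tapes]

theorem Exchange.exists_path {u v : List Letter} (h : Exchange u v) :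
    ∃ w, tapes w = (u, v) ∧ LabelledPath ExchangeStep (.idle, 0) w (.idle, 0) := by
  induction h with
  | nil => exact ⟨[], rfl, .refl _⟩
  | cons x _ ih =>
    obtain ⟨w, hw, h⟩ := ih
    exact ⟨(some x, some x) :: w, by simp [tapes_cons, hw], .step (x := some _) (.letter x) h⟩
  | swap o n _ ih =>
    obtain ⟨w, hw, h⟩ := ih
    have h₁ := ExchangeStep.path_up o n 0
    rw [zero_add] at h₁
    refine ⟨(some .l, some .l) :: (List.replicate n (some (.ofBool o), some (.ofBool !o)) ++
      (List.replicate n (some (.ofBool !o), some (.ofBool o)) ++ (some .r, some .r) :: w)), ?_,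
      .step (x := some _) (.start o) (h₁.trans (.step (x := none) (.turn o n)
        ((ExchangeStep.path_down o n).trans (.step (x := some _) (.finish o) h))))⟩
    simp [tapes_cons, tapes_append, tapes_replicate, hw]

/-- The pairs of words that remain to be read in a configuration on the way to `(idle, 0)`. -/
def ExchangeState.Remainder : ExchangeState × ℕ → List Letter → List Letter → Prop
  | (.idle, _), u, v => Exchange u v
  | (.up o, n), u, v => ∃ k u' v', Exchange u' v' ∧
      u = List.replicate k (.ofBool o) ++ (List.replicate (k + n) (.ofBool !o) ++ .r :: u') ∧
      v = List.replicate k (.ofBool !o) ++ (List.replicate (k + n) (.ofBool o) ++ .r :: v')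
  | (.down o, n), u, v => ∃ u' v', Exchange u' v' ∧
      u = List.replicate n (.ofBool !o) ++ .r :: u' ∧ v = List.replicate n (.ofBool o) ++ .r :: v'

/-- Induction from the end of the path: each move prepends its letters to what remains. In state
`up`, the counter `n` is the number of letters of the first half already read, and `k` the number
still to come. -/
theorem ExchangeStep.remainder_of_path {c : ExchangeState × ℕ}
    {w : List (Option Letter × Option Letter)}
    (h : LabelledPath ExchangeStep c w (.idle, 0)) :
    ExchangeState.Remainder c (tapes w).1 (tapes w).2 := by
  generalize hd : ((.idle, 0) : ExchangeState × ℕ) = d at h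
  induction h with
  | refl c => subst hd; exact .nil
  | step hs _ ih =>
    have ih := ih hd
    cases hs with
    | letter x => simpa [tapes_cons, ExchangeState.Remainder] using Exchange.cons x ih
    | start o =>
      obtain ⟨k, u, v, h, hu, hv⟩ := ih
      have := Exchange.swap o k h
      simpa [tapes_cons, hu, hv, ExchangeState.Remainder] using this
    | up o n =>
      obtain ⟨k, u, v, h, hu, hv⟩ := ih
      refine ⟨k + 1, u, v, h, ?_, ?_⟩
      · simp [tapes_cons, hu, List.replicate_succ, Nat.add_right_comm _ 1 n, ← add_assoc]
      · simp [tapes_cons, hv, List.replicate_succ, Nat.add_right_comm _ 1 n, ← add_assoc]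
    | turn o n =>
      obtain ⟨u, v, h, hu, hv⟩ := ih
      exact ⟨0, u, v, h, by simpa using hu, by simpa using hv⟩
    | down o n =>
      obtain ⟨u, v, h, hu, hv⟩ := ih
      exact ⟨u, v, h, by simp [tapes_cons, hu, List.replicate_succ],
        by simp [tapes_cons, hv, List.replicate_succ]⟩
    | finish o => exact ⟨_, _, ih, by simp [tapes_cons], by simp [tapes_cons]⟩

theorem M₁WordProblem_mem_twoTapeRelations :
    M₁WordProblem ∈ twoTapeRelations OneCounterClass := by
  refine ⟨_, isCounterSystem_exchangeStep.mem_oneCounterClass {.idle} {.idle}, ?_⟩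
  change wordProblem (PresentedMonoid.of M₁Rel) = _
  rw [wordProblem_eq_exchange]
  ext ⟨u, v⟩
  constructor
  · intro h
    obtain ⟨w, hw, hp⟩ := Exchange.exists_path h
    exact ⟨w, ⟨_, rfl, _, rfl, hp⟩, hw⟩
  · rintro ⟨w, ⟨_, rfl, _, rfl, hp⟩, hw⟩
    have := ExchangeStep.remainder_of_path hp
    change tapes (X := Letter) w = _ at hw
    rw [hw] at this
    exact this

/-! ### Interchange of factors -/

/-- Every long word in the language has a factor of prescribed approximate length that may be
replaced by every factor of the same kind, where there are finitely many kinds of factors. -/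
def HasInterchange {A : Type} (L : Language A) : Prop :=
  ∃ (K : Type) (_ : Finite K) (F : K → Set (List A)) (c : ℕ), ∀ m ≥ 1, ∀ w ∈ L, m < w.length →
    ∃ κ x y z, w = x ++ (y ++ z) ∧ y ∈ F κ ∧ m < y.length ∧ y.length ≤ c * m ∧
      ∀ y' ∈ F κ, x ++ (y' ++ z) ∈ L

/-! ### Interchange for context-free languages, by parse trees. -/

section ContextFree

variable {T : Type} {g : ContextFreeGrammar T}

/-- `Parse g s w`: the word `w` is derived from the string `s` by parse trees of `g`. -/
inductive Parse (g : ContextFreeGrammar T) : List (Symbol T g.NT) → List T → Prop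
  | nil : Parse g [] []
  | terminal (t : T) {s w} : Parse g s w → Parse g (.terminal t :: s) (t :: w)
  | nonterminal {r : ContextFreeRule T g.NT} {s u w} : r ∈ g.rules → Parse g r.output u →
      Parse g s w → Parse g (.nonterminal r.input :: s) (u ++ w)

theorem Parse.exists_of_append {s s' : List (Symbol T g.NT)} {w : List T}
    (h : Parse g (s ++ s') w) : ∃ u u', w = u ++ u' ∧ Parse g s u ∧ Parse g s' u' := by
  induction s generalizing w with
  | nil => exact ⟨[], w, rfl, .nil, h⟩
  | cons x s ih =>
    cases h with
    | terminal t h =>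
      obtain ⟨u, u', rfl, h₁, h₂⟩ := ih h
      exact ⟨t :: u, u', rfl, .terminal t h₁, h₂⟩
    | nonterminal hr h₀ h =>
      obtain ⟨u, u', rfl, h₁, h₂⟩ := ih h
      exact ⟨_, u', (List.append_assoc ..).symm, .nonterminal hr h₀ h₁, h₂⟩

theorem Parse.of_produces {s s' : List (Symbol T g.NT)} {w : List T} (hs : g.Produces s s')
    (h : Parse g s' w) : Parse g s w := by
  obtain ⟨r, hr, hs⟩ := hs
  induction hs generalizing w with
  | head s =>
    obtain ⟨u, u', rfl, h₁, h₂⟩ := h.exists_of_append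
    exact .nonterminal hr h₁ h₂
  | cons x _ ih =>
    cases h with
    | terminal t h => exact .terminal t (ih h)
    | nonterminal hr h₀ h => exact .nonterminal hr h₀ (ih h)

theorem parse_iff_derives {s : List (Symbol T g.NT)} {w : List T} :
    Parse g s w ↔ g.Derives s (w.map .terminal) := by
  constructor
  · intro h
    induction h with
    | nil => rfl
    | terminal t _ ih => exact ih.append_left [.terminal t]
    | @nonterminal r s u w hr _ _ ih₁ ih₂ =>
      rw [List.map_append]
      exact (ContextFreeGrammar.Produces.trans_derives ⟨r, hr, .head s⟩
        (ih₁.append_right s)).trans (ih₂.append_left _)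
  · intro h
    induction h using Relation.ReflTransGen.head_induction_on with
    | refl =>
      induction w with
      | nil => exact .nil
      | cons t w ih => exact .terminal t ih
    | head hs _ ih => exact ih.of_produces hs

/-- Since `s.length * m < w.length`, some symbol of `s` yields more than `m` letters, and as `1 ≤ m`
it is a nonterminal. If it yields at most `c * m` letters, its yield is the factor. Otherwise the
output of its rule, having at most `c` symbols, satisfies the same inequality and the search
descends. -/
theorem Parse.exists_factor {c m : ℕ} (hm : 1 ≤ m) (hc : ∀ r ∈ g.rules, r.output.length ≤ c)
    {s : List (Symbol T g.NT)} {w : List T} (h : Parse g s w) (hw : s.length * m < w.length) :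
    ∃ r ∈ g.rules, ∃ x y z, w = x ++ (y ++ z) ∧ Parse g r.output y ∧ m < y.length ∧
      y.length ≤ c * m ∧ ∀ y', Parse g r.output y' → Parse g s (x ++ (y' ++ z)) := by
  induction h with
  | nil => simp at hw
  | terminal t h ih =>
    simp only [List.length_cons, add_mul, one_mul] at hw
    obtain ⟨r, hr, x, y, z, rfl, hy, h₁, h₂, h₃⟩ := ih (by omega)
    exact ⟨r, hr, t :: x, y, z, rfl, hy, h₁, h₂, fun y' hy' => .terminal t (h₃ y' hy')⟩
  | @nonterminal r s u w hr hu hw' ih₁ ih₂ =>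
    simp only [List.length_cons, add_mul, one_mul, List.length_append] at hw
    by_cases hum : u.length ≤ m
    · obtain ⟨r', hr', x, y, z, rfl, hy, h₁, h₂, h₃⟩ := ih₂ (by omega)
      exact ⟨r', hr', u ++ x, y, z, by simp, hy, h₁, h₂,
        fun y' hy' => by simpa using Parse.nonterminal hr hu (h₃ y' hy')⟩
    by_cases huc : u.length ≤ c * m
    · exact ⟨r, hr, [], u, w, rfl, hu, by omega, huc,
        fun y' hy' => by simpa using Parse.nonterminal hr hy' hw'⟩
    · have := Nat.mul_le_mul_right m (hc r hr)
      obtain ⟨r', hr', x, y, z, rfl, hy, h₁, h₂, h₃⟩ := ih₁ (by omega)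
      exact ⟨r', hr', x, y, z ++ w, by simp, hy, h₁, h₂,
        fun y' hy' => by simpa using Parse.nonterminal hr (h₃ y' hy') hw'⟩

theorem Language.IsContextFree.hasInterchange {L : Language T} (hL : L.IsContextFree) :
    HasInterchange L := by
  obtain ⟨g, rfl⟩ := hL
  refine ⟨g.rules, inferInstance, fun r => {y | Parse g r.1.output y},
    g.rules.sup fun r => r.output.length, fun m hm w hw hlen => ?_⟩
  rw [ContextFreeGrammar.mem_language_iff, ← parse_iff_derives] at hw
  obtain ⟨r, hr, x, y, z, rfl, hy, h₁, h₂, h₃⟩ := hw.exists_factor hm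
    (fun r hr => Finset.le_sup (f := fun r => r.output.length) hr) (by simpa using hlen)
  refine ⟨⟨r, hr⟩, x, y, z, rfl, hy, h₁, h₂, fun y' hy' => ?_⟩
  rw [ContextFreeGrammar.mem_language_iff, ← parse_iff_derives]
  exact h₃ y' hy'

end ContextFree

/-! ### Interchange for one-counter languages, by excursions. -/

section OneCounter

variable {A : Type} {M : OneCounterAutomaton A}

/-- `Excursion M z p w q`: the word `w` leads from `p` to `q`, starting and ending with the same
counter value, with greater or equal values in between; `z` tells whether this value is zero. -/
inductive Excursion (M : OneCounterAutomaton A) : Bool → M.State → List A → M.State → Prop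
  | nil {z p} : Excursion M z p [] p
  | keep {z p x q w r} : M.trans p x z .keep q → Excursion M z q w r →
      Excursion M z p (x.toList ++ w) r
  | push {z p x q u q' y p' v r} : M.trans p x z .inc q → Excursion M false q u q' →
      M.trans q' y false .dec p' → Excursion M z p' v r →
      Excursion M z p (x.toList ++ (u ++ (y.toList ++ v))) r

theorem Excursion.path {z : Bool} {p q : M.State} {w : List A} (h : Excursion M z p w q) {n : ℕ}
    (hn : z = decide (n = 0)) : LabelledPath M.Step (p, n) w (q, n) := by
  induction h generalizing n with
  | nil => exact .refl _
  | keep ht _ ih => subst hn; exact .step (.keep ht) (ih rfl)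
  | push ht _ ht' _ ih₁ ih₂ =>
    subst hn
    exact .step (.inc ht) ((ih₁ (by simp)).trans (.step (.dec ht') (ih₂ rfl)))

/-- A descent is a sequence of `n + 1` excursions at the levels `n`, …, `0`. -/
inductive Descent (M : OneCounterAutomaton A) : M.State → ℕ → List A → M.State → Prop
  | zero {p w q} : Excursion M true p w q → Descent M p 0 w q
  | succ {p n u q x p' v r} : Excursion M false p u q → M.trans q x false .dec p' →
      Descent M p' n v r → Descent M p (n + 1) (u ++ (x.toList ++ v)) r

theorem Descent.step {c d : M.State × ℕ} {x : Option A} {w : List A} {r : M.State}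
    (hs : M.Step c x d) (h : Descent M d.1 d.2 w r) :
    Descent M c.1 c.2 (x.toList ++ w) r := by
  cases hs with
  | @inc p q x n ht =>
    generalize hk : n + 1 = k at h
    cases h with
    | zero => simp at hk
    -- The increment, the excursion one level up and the following decrement merge into one `push`
    -- in front of the excursion at level `n`.
    | succ h₁ ht' h₂ =>
      cases hk
      cases h₂ with
      | zero h₂ => exact .zero (.push ht h₁ ht' h₂)
      | succ h₂ ht'' h₃ =>
        have := Descent.succ (.push ht h₁ ht' h₂) ht'' h₃
        simpa using this
  | @keep p q x n ht =>
    cases h with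
    | zero h => exact .zero (.keep ht h)
    | succ h₁ ht' h₂ =>
      have := Descent.succ (.keep ht h₁) ht' h₂
      simpa using this
  | dec ht => exact .succ .nil ht h

theorem excursion_true_iff {p q : M.State} {w : List A} :
    Excursion M true p w q ↔ LabelledPath M.Step (p, 0) w (q, 0) := by
  refine ⟨fun h => h.path rfl, fun h => ?_⟩
  -- The remainder of a run may start at any height, so the induction has to be about descents.
  suffices H : ∀ c w d, LabelledPath M.Step c w d → d.2 = 0 → Descent M c.1 c.2 w d.1 by
    cases H _ _ _ h rfl with
    | zero h => exact h
  intro c w d h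
  induction h with
  | refl c =>
    obtain ⟨p, n⟩ := c
    rintro rfl
    exact .zero .nil
  | step hs _ ih => exact fun hd => .step hs (ih hd)

/-- Descend into a subexcursion longer than `m` until its length is at most `4 * m`. In a longer
`push`, if the inner excursion has length at most `m`, the remaining one has length over `4 * m - m
- 2 ≥ m`, because `1 ≤ m`. -/
theorem Excursion.exists_factor {m : ℕ} (hm : 1 ≤ m) {z : Bool} {p q : M.State} {w : List A}
    (h : Excursion M z p w q) (hw : m < w.length) :
    ∃ z' p' q' x y v, w = x ++ (y ++ v) ∧ Excursion M z' p' y q' ∧ m < y.length ∧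
      y.length ≤ 4 * m ∧ ∀ y', Excursion M z' p' y' q' → Excursion M z p (x ++ (y' ++ v)) q := by
  have hopt (x : Option A) : x.toList.length ≤ 1 := by cases x <;> simp
  induction h with
  | nil => simp at hw
  | @keep z p x q w r ht h ih =>
    by_cases hlen : (x.toList ++ w).length ≤ 4 * m
    · exact ⟨z, p, r, [], _, [], by simp, .keep ht h, hw, hlen, by simp⟩
    rw [List.length_append] at hlen
    obtain ⟨z', p', q', x', y, v, rfl, hy, h₁, h₂, h₃⟩ := ih (by have := hopt x; omega)
    exact ⟨z', p', q', x.toList ++ x', y, v, by simp, hy, h₁, h₂,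
      fun y' hy' => by simpa using Excursion.keep ht (h₃ y' hy')⟩
  | @push z p x q u q' y p' v r ht hu ht' hv ih₁ ih₂ =>
    by_cases hlen : (x.toList ++ (u ++ (y.toList ++ v))).length ≤ 4 * m
    · exact ⟨z, p, r, [], _, [], by simp, .push ht hu ht' hv, hw, hlen, by simp⟩
    simp only [List.length_append] at hlen
    by_cases hum : m < u.length
    · obtain ⟨z', p', q', x', y', v', rfl, hy, h₁, h₂, h₃⟩ := ih₁ hum
      exact ⟨z', p', q', x.toList ++ x', y', v' ++ (y.toList ++ v), by simp, hy, h₁, h₂,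
        fun y' hy' => by simpa using Excursion.push ht (h₃ y' hy') ht' hv⟩
    · obtain ⟨z', p', q', x', y', v', rfl, hy, h₁, h₂, h₃⟩ :=
        ih₂ (by have := hopt x; have := hopt y; omega)
      exact ⟨z', p', q', x.toList ++ (u ++ (y.toList ++ x')), y', v', by simp, hy, h₁, h₂,
        fun y' hy' => by simpa using Excursion.push ht hu ht' (h₃ y' hy')⟩

theorem hasInterchange_of_mem_oneCounterClass {L : Language A} (hL : L ∈ OneCounterClass A) :
    HasInterchange L := by
  obtain ⟨M, rfl⟩ := hL
  have := M.finiteState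
  refine ⟨Bool × M.State × M.State, inferInstance, fun κ => {y | Excursion M κ.1 κ.2.1 y κ.2.2},
    4, ?_⟩
  rintro m hm w ⟨f, hf, hw⟩ hlen
  rw [M.run_iff_path, ← excursion_true_iff] at hw
  obtain ⟨z', p', q', x, y, v, rfl, hy, h₁, h₂, h₃⟩ := hw.exists_factor hm hlen
  refine ⟨(z', p', q'), x, y, v, rfl, hy, h₁, h₂, fun y' hy' => ⟨f, hf, ?_⟩⟩
  rw [M.run_iff_path, ← excursion_true_iff]
  exact h₃ y' hy'

end OneCounter

/-! ### The word problem of `M₁` has no context-free unfolding -/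

instance : DecidableEq Letter := fun x y => by
  cases x <;> cases y <;> first | exact isTrue rfl | exact isFalse (by simp)

theorem length_eq_sum_count (w : List (Option Letter)) :
    w.length = w.count none + w.count (some .a) + w.count (some .b) + w.count (some .l) +
      w.count (some .r) := by
  induction w with
  | nil => rfl
  | cons x w ih =>
    rcases x with _ | _ | _ | _ | _ <;> simp [ih] <;> omega

/-- Swaps only permute letters, so both sides of the marker have equal letter counts. The refutation
needs no finer invariant. -/
theorem perm_of_append_none_cons_mem {P Q : List (Option Letter)}
    (h : P ++ none :: Q ∈ unfolding (wordProblem (PresentedMonoid.of M₁Rel))) : P.Perm Q := by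
  obtain ⟨u, v, huv, h⟩ := h
  rw [wordProblem_eq_exchange] at huv
  rw [List.append_assoc, List.singleton_append, eq_comm,
    List.append_cons_inj_of_notMem (by simp) (by simp)] at h
  obtain ⟨rfl, -, rfl⟩ := h
  exact (huv.perm.trans (List.reverse_perm v).symm).map _

theorem count_none_of_mem {w : List (Option Letter)}
    (h : w ∈ unfolding (wordProblem (PresentedMonoid.of M₁Rel))) : w.count none = 1 := by
  obtain ⟨u, v, -, rfl⟩ := h
  simp [List.count_eq_zero_of_not_mem]

/-- The part before the marker of the word `l aⁿ bⁿ r # r aⁿ bⁿ l`. -/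
def blockLeft (n : ℕ) : List (Option Letter) :=
  some .l :: (List.replicate n (some .a) ++ (List.replicate n (some .b) ++ [some .r]))

/-- The part after the marker of the word `l aⁿ bⁿ r # r aⁿ bⁿ l`. -/
def blockRight (n : ℕ) : List (Option Letter) :=
  (some .r :: List.replicate n (some .a)) ++ (List.replicate n (some .b) ++ [some .l])

theorem block_mem (n : ℕ) : blockLeft n ++ none :: blockRight n ∈
    unfolding (wordProblem (PresentedMonoid.of M₁Rel)) := by
  rw [wordProblem_eq_exchange]
  exact ⟨_, _, Exchange.swap true n .nil, by simp [blockLeft, blockRight, Letter.ofBool]⟩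

theorem none_notMem_blockLeft (n : ℕ) : none ∉ blockLeft n := by
  simp [blockLeft, List.mem_replicate]

theorem none_notMem_blockRight (n : ℕ) : none ∉ blockRight n := by
  simp [blockRight, List.mem_replicate]

/-- A short factor of `l aⁿ bⁿ r # r aⁿ bⁿ l` around the marker has no letters `a` on the left and
no letters `b` on the right. -/
theorem count_of_factor {n : ℕ} {x y z : List (Option Letter)} (hy : y.length ≤ n)
    (h : blockLeft n ++ none :: blockRight n = x ++ (y ++ z)) (hm : none ∈ y) :
    ∃ y₁ y₂, y = y₁ ++ none :: y₂ ∧ y₁.length = y₁.count (some .b) + y₁.count (some .r) ∧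
      y₂.length = y₂.count (some .a) + y₂.count (some .r) ∧ y₁.count (some .r) ≤ 1 ∧
      y₂.count (some .r) ≤ 1 := by
  obtain ⟨y₁, y₂, rfl⟩ := List.append_of_mem hm
  have h : blockLeft n ++ none :: blockRight n = x ++ y₁ ++ none :: (y₂ ++ z) := by simp [h]
  rw [List.append_cons_inj_of_notMem (none_notMem_blockLeft n) (none_notMem_blockRight n)] at h
  obtain ⟨h₁, -, h₂⟩ := h
  simp only [List.length_append, List.length_cons] at hy
  have h₁ : y₁.Sublist (List.replicate n (some .b) ++ [some .r]) :=
    (List.suffix_of_suffix_length_le (l₃ := blockLeft n) ⟨x, h₁.symm⟩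
      ⟨some .l :: List.replicate n (some .a), by simp [blockLeft]⟩ (by simp; omega)).sublist
  have h₂ : y₂.Sublist (some .r :: List.replicate n (some .a)) :=
    (List.prefix_of_prefix_length_le (l₃ := blockRight n) ⟨z, h₂.symm⟩
      ⟨List.replicate n (some .b) ++ [some .l], by simp [blockRight]⟩ (by simp; omega)).sublist
  have e₁ := length_eq_sum_count y₁
  have e₂ := length_eq_sum_count y₂
  have c₁ (s) := h₁.count_le s
  have c₂ (s) := h₂.count_le s
  have := c₁ none
  have := c₁ (some .a)
  have := c₁ (some .l)
  have := c₁ (some .r)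
  have := c₂ none
  have := c₂ (some .b)
  have := c₂ (some .l)
  have := c₂ (some .r)
  simp [List.count_replicate, List.count_cons] at *
  refine ⟨y₁, y₂, rfl, ?_⟩
  omega

/-- If `y` contains the marker, then so does `y'`. Balance of the letters `a` and `b` in both words
then forces equally many `a` to the right of the marker in `y` and `y'`, and equally many `b` to the
left; only one `r` on each side can differ, hence the 2. If `y` avoids the marker, one side of the
word is unchanged, so the lengths of `y` and `y'` agree. -/
theorem length_le_of_interchange {n n' : ℕ} {x y z x' y' z' : List (Option Letter)}
    (hy : y.length ≤ n) (hy' : y'.length ≤ n')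
    (h : blockLeft n ++ none :: blockRight n = x ++ (y ++ z))
    (h' : blockLeft n' ++ none :: blockRight n' = x' ++ (y' ++ z'))
    (hmem : x ++ (y' ++ z) ∈ unfolding (wordProblem (PresentedMonoid.of M₁Rel))) :
    y'.length ≤ y.length + 2 := by
  have hmem₀ := block_mem n
  rw [h] at hmem₀
  have hcount : y.count none = y'.count none := by
    have h₀ := count_none_of_mem hmem₀
    have h₁ := count_none_of_mem hmem
    simp only [List.count_append] at h₀ h₁
    omega
  by_cases hm : none ∈ y
  · have hm' : none ∈ y' := by
      rw [← List.count_pos_iff] at hm ⊢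
      omega
    obtain ⟨y₁, y₂, rfl, h₁, h₂, h₃, h₄⟩ := count_of_factor hy h hm
    obtain ⟨y₁', y₂', rfl, h₁', h₂', h₃', h₄'⟩ := count_of_factor hy' h' hm'
    have p := perm_of_append_none_cons_mem (P := x ++ y₁) (Q := y₂ ++ z) (by simpa using hmem₀)
    have p' := perm_of_append_none_cons_mem (P := x ++ y₁') (Q := y₂' ++ z) (by simpa using hmem)
    have e (s) := p.count_eq s
    have e' (s) := p'.count_eq s
    have ea := e (some .a)
    have eb := e (some .b)
    have ea' := e' (some .a)
    have eb' := e' (some .b)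
    have l₁ := length_eq_sum_count y₁
    have l₂ := length_eq_sum_count y₂
    have l₁' := length_eq_sum_count y₁'
    have l₂' := length_eq_sum_count y₂'
    simp only [List.count_append, List.length_append, List.length_cons] at *
    omega
  · have hxz : none ∈ x ∨ none ∈ z := by
      have : none ∈ x ++ (y ++ z) := by simp [← h]
      simpa [hm] using this
    obtain hx | hz := hxz
    · obtain ⟨x₁, x₂, rfl⟩ := List.append_of_mem hx
      have p := perm_of_append_none_cons_mem (P := x₁) (Q := x₂ ++ (y ++ z)) (by simpa using hmem₀)
      have p' := perm_of_append_none_cons_mem (P := x₁) (Q := x₂ ++ (y' ++ z)) (by simpa using hmem)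
      have := p.length_eq
      have := p'.length_eq
      simp only [List.length_append] at *
      omega
    · obtain ⟨z₁, z₂, rfl⟩ := List.append_of_mem hz
      have p := perm_of_append_none_cons_mem (P := x ++ (y ++ z₁)) (Q := z₂) (by simpa using hmem₀)
      have p' := perm_of_append_none_cons_mem (P := x ++ (y' ++ z₁)) (Q := z₂)
        (by simpa using hmem)
      have := p.length_eq
      have := p'.length_eq
      simp only [List.length_append] at *
      omega

/-- Choose factors at the scales `m = (c + 5) ^ i`. By pigeonhole two of them, for `i < j`, have the
same kind; but the later one is longer than `(c + 5) * (c + 5) ^ i`, whereas interchange bounds it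
by `c * (c + 5) ^ i + 2`. -/
theorem not_hasInterchange_unfolding_wordProblem :
    ¬ HasInterchange (unfolding (wordProblem (PresentedMonoid.of M₁Rel))) := by
  rintro ⟨K, hK, F, c, H⟩
  have hpos (i : ℕ) : 1 ≤ (c + 5) ^ i := Nat.one_le_pow _ _ (by omega)
  -- Exponent `(c + 1) * m` makes the factor, of length at most `c * m`, no longer than one run of
  -- letters; the `+ 1` keeps the word longer than `m` even if `c = 0`.
  have H' (i : ℕ) := H ((c + 5) ^ i) (hpos i) _ (block_mem ((c + 1) * (c + 5) ^ i)) (by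
    have : (c + 5) ^ i ≤ (c + 1) * (c + 5) ^ i := Nat.le_mul_of_pos_left _ (Nat.succ_pos c)
    simp only [blockLeft, blockRight, List.length_append, List.length_cons, List.length_replicate,
      List.length_nil]
    omega)
  choose κ x y z hw hy hlt hle hswap using H'
  have hlen (i : ℕ) : (y i).length ≤ (c + 1) * (c + 5) ^ i :=
    (hle i).trans (Nat.mul_le_mul_right _ (by omega))
  have hne (i j : ℕ) (hij : i < j) : κ i ≠ κ j := by
    intro e
    have h₁ := length_le_of_interchange (hlen i) (hlen j) (hw i) (hw j)
      (hswap i (y j) (e ▸ hy j))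
    have h₂ := hlt j
    have h₃ := hle i
    have h₄ : (c + 5) ^ (i + 1) ≤ (c + 5) ^ j := Nat.pow_le_pow_right (by omega) hij
    have h₅ := hpos i
    rw [pow_succ'] at h₄
    nlinarith
  obtain ⟨i, j, hij, e⟩ := Finite.exists_ne_map_eq_of_infinite κ
  obtain h | h := lt_or_gt_of_ne hij
  · exact hne i j h e
  · exact hne j i h e.symm

theorem proposition4p2 :
    unfoldedRelations OneCounterClass ⊂ twoTapeRelations OneCounterClass ∧
      M₁WordProblem ∈ twoTapeRelations OneCounterClass ∧
      M₁WordProblem ∉ unfoldedRelations ContextFreeClass := by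
  refine ⟨⟨unfoldedRelations_subset_twoTapeRelations, fun h => ?_⟩,
    M₁WordProblem_mem_twoTapeRelations, fun h => ?_⟩
  · exact not_hasInterchange_unfolding_wordProblem
      (hasInterchange_of_mem_oneCounterClass (h M₁WordProblem_mem_twoTapeRelations))
  · exact not_hasInterchange_unfolding_wordProblem (Language.IsContextFree.hasInterchange h)
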